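/- \textbf{Lemma.} Let $r,s\ge 3$ be odd integers and $\ell\ge 1$ an integer. Let $D_{r,s,\ell}$ be the dumbbell graph, obtained from vertex disjoint cycles $C_r$ and $C_s$ by choosing one vertex on each and joining them by a path of length $\ell$. A complex unit gain graph $\Phi$ on $D_{r,s,\ell}$ is an assignment of a complex number $\varphi(u,v)$ of modulus $1$ to each oriented edge such that $\varphi(v,u)=\varphi(u,v)^{-1}$. Its Hermitian adjacency matrix has the entry $\varphi(u,v)$ if $u\sim v$ and $0$ otherwise, and its energy $E(\Phi)$ is the sum of the absolute values of the eigenvalues of this matrix, counted with multiplicity. Let $\gamma_r,\gamma_s$ be the gains of the cycles $C_r,C_s$ (the products of the gains of the edges along the cycle, in either direction), and put \[ \alpha=(-1)^{(r+1)/2}\operatorname{Re}\gamma_r,\qquad \beta=(-1)^{(s+1)/2}\operatorname{Re}\gamma_s . \] Define polynomials in $u$ by $f_{-1}=0$, $f_0=1$, $f_j=f_{j-1}+u f_{j-2}$ and $g_j=f_j+u f_{j-2}$ for $j\ge 1$, and let \[ T=f_{\ell-1},\qquad R=f_{\ell-1}g_s+u f_{\ell-2}f_{s-1},\qquad S=f_{\ell-1}g_r+u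 f_{\ell-2}f_{r-1}, \] \[ M=\begin{cases} g_rg_s+u f_{r-1}f_{s-1}, & \ell=1,\\ f_{\ell-1}g_rg_s+u f_{\ell-2}\left(f_{r-1}g_s+f_{s-1}g_r\right)+u^2 f_{\ell-3}f_{r-1}f_{s-1}, & \ell\ge 2.\end{cases} \] For $t>0$ put $Z(t)=M(t^2)$, $W(t)=4t^{r+s}T(t^2)$, $X(t)=2t^rR(t^2)$, $Y(t)=2t^sS(t^2)$ and \[ K(t;\alpha,\beta)=\left(Z(t)-\alpha\beta W(t)\right)^2+\left(\alpha X(t)+\beta Y(t)\right)^2 . \] Then: (1) for every complex unit gain graph $\Phi$ on $D_{r,s,\ell}$, with $\alpha,\beta$ as above, $K(t;\alpha,\beta)>0$ for all $t>0$, the function $t\mapsto t^{-2}\log K(t;\alpha,\beta)$ is integrable on $(0,\infty)$, and \[ E(\Phi)=\frac1\pi\int_0^\infty \frac{1}{t^2}\log K(t;\alpha,\beta)\,dt ; \] (2) $R(u)S(u)-M(u)T(u)=(-1)^\ell u^\ell f_{r-1}(u)f_{s-1}(u)$ as polynomials in $u$; (3) $\operatorname{sgn}\left(X(t)Y(t)-Z(t)W(t)\right)=(-1)^\ell$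 for all $t>0$. -/

import Mathlib

open scoped Polynomial

namespace GainDumbbell

/-- A complex unit gain graph on the simple graph `G`: every oriented edge carries a complex
number of modulus one, and reversing an oriented edge inverts its gain. -/
structure UnitGain {V : Type*} (G : SimpleGraph V) where
  gain : G.Dart → Circle
  gain_symm : ∀ d : G.Dart, gain d.symm = (gain d)⁻¹

namespace UnitGain

variable {V : Type*} {G : SimpleGraph V}

open Classical in
/-- The Hermitian adjacency matrix: the gain of `(u, v)` if `u` and `v` are adjacent,
and `0` otherwise. -/
noncomputable def adjMatrix (Φ : UnitGain G) : Matrix V V ℂ :=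
  fun u v => if h : G.Adj u v then (Φ.gain ⟨(u, v), h⟩ : ℂ) else 0

theorem adjMatrix_isHermitian (Φ : UnitGain G) : Φ.adjMatrix.IsHermitian := by
  ext u v
  rw [Matrix.conjTranspose_apply]
  unfold adjMatrix
  by_cases h : G.Adj u v
  · have h' : G.Adj v u := h.symm
    have key := Φ.gain_symm ⟨(u, v), h⟩
    have e : (SimpleGraph.Dart.symm ⟨(u, v), h⟩ : G.Dart) = ⟨(v, u), h'⟩ := rfl
    rw [e] at key
    rw [dif_pos h', dif_pos h, key, Circle.coe_inv_eq_conj]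
    simp
  · have h' : ¬ G.Adj v u := fun k => h k.symm
    rw [dif_neg h', dif_neg h]
    simp

/-- The energy: the sum of the absolute values of the eigenvalues (with multiplicity) of the
Hermitian adjacency matrix. -/
noncomputable def energy [Fintype V] [DecidableEq V] (Φ : UnitGain G) : ℝ :=
  ∑ j, |Φ.adjMatrix_isHermitian.eigenvalues j|

/-- The gain of the closed walk `c 0, c 1, …, c (m - 1), c 0`: the product of the gains of its
oriented edges (`finRotate m` sends `i` to `i + 1` modulo `m`). -/
noncomputable def cycleGain (Φ : UnitGain G) {m : ℕ} (c : Fin m → V)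
    (hc : ∀ i, G.Adj (c i) (c (finRotate m i))) : Circle :=
  ∏ i, Φ.gain ⟨(c i, c (finRotate m i)), hc i⟩

end UnitGain

/-- Vertices of the dumbbell graph: those of the first cycle, those of the second cycle, and the
`ℓ - 1` interior vertices of the connecting path. -/
abbrev Vertex (r s ℓ : ℕ) : Type := Fin r ⊕ Fin s ⊕ Fin (ℓ - 1)

/-- Adjacency in the dumbbell graph. The path of length `ℓ` joins vertex `0` of the first cycle
to vertex `0` of the second one; it is a single edge if `ℓ = 1`. -/
def DumbbellAdj (r s ℓ : ℕ) : Vertex r s ℓ → Vertex r s ℓ → Prop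
  | .inl i, .inl j => (SimpleGraph.cycleGraph r).Adj i j
  | .inr (.inl i), .inr (.inl j) => (SimpleGraph.cycleGraph s).Adj i j
  | .inr (.inr p), .inr (.inr q) => (SimpleGraph.pathGraph (ℓ - 1)).Adj p q
  | .inl i, .inr (.inl j) => ℓ = 1 ∧ i.val = 0 ∧ j.val = 0
  | .inr (.inl j), .inl i => ℓ = 1 ∧ i.val = 0 ∧ j.val = 0
  | .inl i, .inr (.inr p) => i.val = 0 ∧ p.val = 0
  | .inr (.inr p), .inl i => i.val = 0 ∧ p.val = 0
  | .inr (.inl j), .inr (.inr p) => j.val = 0 ∧ p.val + 2 = ℓ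
  | .inr (.inr p), .inr (.inl j) => j.val = 0 ∧ p.val + 2 = ℓ

/-- The dumbbell graph `D_{r,s,ℓ}` (for `r, s ≥ 3` and `ℓ ≥ 1`). -/
def dumbbell (r s ℓ : ℕ) : SimpleGraph (Vertex r s ℓ) where
  Adj := DumbbellAdj r s ℓ
  symm := ⟨by
    rintro (i | i | i) (j | j | j) h
    · exact SimpleGraph.Adj.symm (G := SimpleGraph.cycleGraph r) h
    · exact h
    · exact h
    · exact h
    · exact SimpleGraph.Adj.symm (G := SimpleGraph.cycleGraph s) h
    · exact h
    · exact h
    · exact h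
    · exact SimpleGraph.Adj.symm (G := SimpleGraph.pathGraph (ℓ - 1)) h⟩
  loopless := ⟨by
    rintro (i | i | i) h
    · exact SimpleGraph.irrefl (SimpleGraph.cycleGraph r) h
    · exact SimpleGraph.irrefl (SimpleGraph.cycleGraph s) h
    · exact SimpleGraph.irrefl (SimpleGraph.pathGraph (ℓ - 1)) h⟩

theorem cycleGraph_adj_finRotate {m : ℕ} (hm : 3 ≤ m) (i : Fin m) :
    (SimpleGraph.cycleGraph m).Adj i (finRotate m i) := by
  obtain ⟨k, rfl⟩ : ∃ k, m = k + 2 := ⟨m - 2, by omega⟩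
  rw [SimpleGraph.cycleGraph_adj, finRotate_apply]
  right
  simp

theorem dumbbell_adj_left {r : ℕ} (hr : 3 ≤ r) (s ℓ : ℕ) (i : Fin r) :
    (dumbbell r s ℓ).Adj (.inl i) (.inl (finRotate r i)) :=
  cycleGraph_adj_finRotate hr i

theorem dumbbell_adj_right (r : ℕ) {s : ℕ} (hs : 3 ≤ s) (ℓ : ℕ) (i : Fin s) :
    (dumbbell r s ℓ).Adj (.inr (.inl i)) (.inr (.inl (finRotate s i))) :=
  cycleGraph_adj_finRotate hs i

/-- The gain of the cycle `C_r` of a gain graph on `D_{r,s,ℓ}`. -/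
noncomputable def gainLeft {r s ℓ : ℕ} (hr : 3 ≤ r) (Φ : UnitGain (dumbbell r s ℓ)) : Circle :=
  Φ.cycleGain (fun i : Fin r => .inl i) (dumbbell_adj_left hr s ℓ)

/-- The gain of the cycle `C_s` of a gain graph on `D_{r,s,ℓ}`. -/
noncomputable def gainRight {r s ℓ : ℕ} (hs : 3 ≤ s) (Φ : UnitGain (dumbbell r s ℓ)) : Circle :=
  Φ.cycleGain (fun i : Fin s => .inr (.inl i)) (dumbbell_adj_right r hs ℓ)

/-- The sign `δ_r = (-1)^((r+1)/2)`, for odd `r`. -/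
def delta (r : ℕ) : ℝ := (-1) ^ ((r + 1) / 2)

/-- `α = δ_r Re(γ_r)`. -/
noncomputable def alpha {r s ℓ : ℕ} (hr : 3 ≤ r) (Φ : UnitGain (dumbbell r s ℓ)) : ℝ :=
  delta r * (gainLeft hr Φ : ℂ).re

/-- `β = δ_s Re(γ_s)`. -/
noncomputable def beta {r s ℓ : ℕ} (hs : 3 ≤ s) (Φ : UnitGain (dumbbell r s ℓ)) : ℝ :=
  delta s * (gainRight hs Φ : ℂ).re

/-- The polynomials `f_j` with the index shifted by one: `fAux k = f_{k-1}`. -/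
noncomputable def fAux : ℕ → ℝ[X]
  | 0 => 0
  | 1 => 1
  | k + 2 => fAux (k + 1) + Polynomial.X * fAux k

/-- The polynomials `f_j`, `j ≥ -1`, with `f_{-1} = 0`, `f_0 = 1` and
`f_j = f_{j-1} + u f_{j-2}` for `j ≥ 1` (indices below `-1` are never used). -/
noncomputable def f (j : ℤ) : ℝ[X] := fAux (j + 1).toNat

theorem f_neg_one : f (-1) = 0 := rfl

theorem f_zero : f 0 = 1 := rfl

theorem f_rec (j : ℤ) (hj : 1 ≤ j) : f j = f (j - 1) + Polynomial.X * f (j - 2) := by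
  obtain ⟨k, rfl⟩ : ∃ k : ℕ, j = k + 1 := ⟨(j - 1).toNat, by omega⟩
  have h0 : ((k : ℤ) + 1 + 1).toNat = k + 2 := by omega
  have h1 : ((k : ℤ) + 1 - 1 + 1).toNat = k + 1 := by omega
  have h2 : ((k : ℤ) + 1 - 2 + 1).toNat = k := by omega
  simp only [f, h0, h1, h2, fAux]

/-- The polynomials `g_j = f_j + u f_{j-2}`, `j ≥ 1`. -/
noncomputable def g (j : ℤ) : ℝ[X] := f j + Polynomial.X * f (j - 2)

noncomputable def polyT (ℓ : ℕ) : ℝ[X] := f (ℓ - 1)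

noncomputable def polyR (s ℓ : ℕ) : ℝ[X] :=
  f (ℓ - 1) * g s + Polynomial.X * f (ℓ - 2) * f (s - 1)

noncomputable def polyS (r ℓ : ℕ) : ℝ[X] :=
  f (ℓ - 1) * g r + Polynomial.X * f (ℓ - 2) * f (r - 1)

noncomputable def polyM (r s ℓ : ℕ) : ℝ[X] :=
  if ℓ = 1 then
    g r * g s + Polynomial.X * f (r - 1) * f (s - 1)
  else
    f (ℓ - 1) * g r * g s
      + Polynomial.X * f (ℓ - 2) * (f (r - 1) * g s + f (s - 1) * g r)
      + Polynomial.X ^ 2 * f (ℓ - 3) * f (r - 1) * f (s - 1)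

noncomputable def kerZ (r s ℓ : ℕ) (t : ℝ) : ℝ := (polyM r s ℓ).eval (t ^ 2)

noncomputable def kerW (r s ℓ : ℕ) (t : ℝ) : ℝ := 4 * t ^ (r + s) * (polyT ℓ).eval (t ^ 2)

noncomputable def kerX (r s ℓ : ℕ) (t : ℝ) : ℝ := 2 * t ^ r * (polyR s ℓ).eval (t ^ 2)

noncomputable def kerY (r s ℓ : ℕ) (t : ℝ) : ℝ := 2 * t ^ s * (polyS r ℓ).eval (t ^ 2)

/-- The kernel `K(t; α, β) = (Z - αβW)² + (αX + βY)²`. -/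
noncomputable def kernelK (r s ℓ : ℕ) (a b t : ℝ) : ℝ :=
  (kerZ r s ℓ t - a * b * kerW r s ℓ t) ^ 2 + (a * kerX r s ℓ t + b * kerY r s ℓ t) ^ 2

end GainDumbbell

/-! The energy formula is of Coulson type. For real `c`, the integral of `t⁻² log (1 + t²c²)` over
`(0, ∞)` is `π|c|`. Summing over the eigenvalues of the adjacency matrix `A` expresses the energy
through `|det (1 + itA)|² = ∏ (1 + t²λ²)` (`UnitGain.energy_eq_integral`), so it remains to show
that this squared modulus is `K`.

With `u = t²`, opposite entries of `1 + itA` have product `-u`. Path determinants therefore obey the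
recurrence of the `f_j`, and an odd cycle contributes `g_m(u) - 2i δ_m Re(γ_m) t^m`
(`UnitGain.det_submatrix_cycle`). Eliminating each cycle by a Schur complement only changes one
diagonal entry at the vertex where it is attached (`det_of_single_coupling`). The result has real
part `Z - αβW` and imaginary part `-(αX + βY)` (`det_shifted_eq`).

Claim (2) reduces to a Cassini identity for the `f_j`; claim (3) is (2) evaluated at `t²`, where the
`f_j` with `j ≥ 0` are positive. -/

namespace GainDumbbell

/-! ### The Coulson integral and the energy. -/

open Filter Topology MeasureTheory in
theorem tendsto_log_one_add_sq_div (c : ℝ) :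
    Tendsto (fun t : ℝ => Real.log (1 + t ^ 2 * c ^ 2) / t) atTop (𝓝 0) := by
  -- The upper bound comes from `1 + t²c² ≤ (1 + c²)t²`, valid for `t ≥ 1`.
  have h0 : Tendsto (fun t : ℝ => (Real.log (1 + c ^ 2) + 2 * Real.log t) / t) atTop (𝓝 0) := by
    have h1 : Tendsto (fun t : ℝ => Real.log t / t) atTop (𝓝 0) := by
      simpa using Real.isLittleO_log_id_atTop.tendsto_div_nhds_zero
    have h2 : Tendsto (fun t : ℝ => Real.log (1 + c ^ 2) / t) atTop (𝓝 0) :=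
      tendsto_const_nhds.div_atTop tendsto_id
    have := h2.add (h1.const_mul 2)
    simp only [mul_zero, add_zero] at this
    refine this.congr fun t => ?_
    ring
  refine tendsto_of_tendsto_of_tendsto_of_le_of_le' tendsto_const_nhds h0 ?_ ?_
  · filter_upwards [eventually_gt_atTop 0] with t ht
    exact div_nonneg (Real.log_nonneg (by nlinarith [mul_nonneg (sq_nonneg t) (sq_nonneg c)])) ht.le
  · filter_upwards [eventually_ge_atTop 1] with t ht
    have ht0 : 0 < t := by linarith
    refine div_le_div_of_nonneg_right ?_ ht0.le
    have e : Real.log (1 + c ^ 2) + 2 * Real.log t = Real.log ((1 + c ^ 2) * t ^ 2) := by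
      rw [Real.log_mul (by positivity) (by positivity), Real.log_pow]
      norm_num
    rw [e]
    refine Real.log_le_log (by positivity) ?_
    nlinarith

/-- The antiderivative comes from integration by parts: the remaining integrand `2c² / (1 + c²t²)`
integrates to the arctangent term. -/
theorem hasDerivAt_arctan_sub_log_div (c : ℝ) {t : ℝ} (ht : 0 < t) :
    HasDerivAt (fun t : ℝ => 2 * c * Real.arctan (c * t) - Real.log (1 + t ^ 2 * c ^ 2) / t)
      (1 / t ^ 2 * Real.log (1 + t ^ 2 * c ^ 2)) t := by
  have hp : 0 < 1 + t ^ 2 * c ^ 2 := by positivity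
  have h1 : HasDerivAt (fun t : ℝ => c * t) c t := by
    simpa using (hasDerivAt_id t).const_mul c
  have h2 : HasDerivAt (fun t : ℝ => 1 + t ^ 2 * c ^ 2) (2 * t * c ^ 2) t := by
    simpa using ((hasDerivAt_pow 2 t).mul_const (c ^ 2)).const_add 1
  have h3 := (h1.arctan.const_mul (2 * c)).sub ((h2.log hp.ne').div (hasDerivAt_id t) ht.ne')
  refine h3.congr_deriv ?_
  have hp' : 1 + (c * t) ^ 2 ≠ 0 := by positivity
  simp only [id]
  rw [show 1 + (c * t) ^ 2 = 1 + t ^ 2 * c ^ 2 by ring]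
  have := hp.ne'
  field_simp
  ring

open Filter Topology in
theorem continuousWithinAt_arctan_sub_log_div (c : ℝ) :
    ContinuousWithinAt
      (fun t : ℝ => 2 * c * Real.arctan (c * t) - Real.log (1 + t ^ 2 * c ^ 2) / t)
      (Set.Ici 0) 0 := by
  have h1 : Continuous fun t : ℝ => 2 * c * Real.arctan (c * t) := by fun_prop
  refine h1.continuousWithinAt.sub ?_
  -- The conventional value `x / 0 = 0` is also the true limit, since `0 ≤ log (1 + t²c²) / t ≤
  -- tc²`.
  have hz : Real.log (1 + (0 : ℝ) ^ 2 * c ^ 2) / 0 = 0 := by simp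
  rw [ContinuousWithinAt, hz]
  have h2 : Tendsto (fun t : ℝ => t * c ^ 2) (𝓝[Set.Ici 0] 0) (𝓝 0) := by
    have : Continuous fun t : ℝ => t * c ^ 2 := by fun_prop
    simpa using (this.tendsto 0).mono_left nhdsWithin_le_nhds
  refine tendsto_of_tendsto_of_tendsto_of_le_of_le' tendsto_const_nhds h2 ?_ ?_
  · filter_upwards [self_mem_nhdsWithin] with t ht
    exact div_nonneg (Real.log_nonneg (by nlinarith [mul_nonneg (sq_nonneg t) (sq_nonneg c)])) ht
  · filter_upwards [self_mem_nhdsWithin] with t ht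
    rcases (Set.mem_Ici.1 ht).eq_or_lt with h | h
    · simp [← h]
    · rw [div_le_iff₀ h]
      have := Real.log_le_sub_one_of_pos (show 0 < 1 + t ^ 2 * c ^ 2 by positivity)
      nlinarith

open Filter Topology in
theorem tendsto_arctan_sub_log_div (c : ℝ) :
    Tendsto (fun t : ℝ => 2 * c * Real.arctan (c * t) - Real.log (1 + t ^ 2 * c ^ 2) / t) atTop
      (𝓝 (Real.pi * |c|)) := by
  have h : Tendsto (fun t : ℝ => 2 * c * Real.arctan (c * t)) atTop (𝓝 (Real.pi * |c|)) := by
    rcases lt_trichotomy c 0 with hc | rfl | hc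
    · have := ((Real.tendsto_arctan_atBot.mono_right nhdsWithin_le_nhds).comp
        (tendsto_id.const_mul_atTop_of_neg hc)).const_mul (2 * c)
      rw [abs_of_neg hc, show Real.pi * -c = 2 * c * -(Real.pi / 2) by ring]
      exact this
    · simp
    · have := ((Real.tendsto_arctan_atTop.mono_right nhdsWithin_le_nhds).comp
        (tendsto_id.const_mul_atTop hc)).const_mul (2 * c)
      rw [abs_of_pos hc, show Real.pi * c = 2 * c * (Real.pi / 2) by ring]
      exact this
  simpa using h.sub (tendsto_log_one_add_sq_div c)

theorem log_one_add_sq_div_nonneg (c t : ℝ) :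
    0 ≤ 1 / t ^ 2 * Real.log (1 + t ^ 2 * c ^ 2) :=
  mul_nonneg (by positivity)
    (Real.log_nonneg (by nlinarith [mul_nonneg (sq_nonneg t) (sq_nonneg c)]))

open MeasureTheory in
theorem integrableOn_log_one_add_sq_div (c : ℝ) :
    IntegrableOn (fun t : ℝ => 1 / t ^ 2 * Real.log (1 + t ^ 2 * c ^ 2)) (Set.Ioi 0) :=
  integrableOn_Ioi_deriv_of_nonneg (continuousWithinAt_arctan_sub_log_div c)
    (fun _ ht => hasDerivAt_arctan_sub_log_div c ht) (fun t _ => log_one_add_sq_div_nonneg c t)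
    (tendsto_arctan_sub_log_div c)

open MeasureTheory in
theorem integral_log_one_add_sq_div (c : ℝ) :
    ∫ t in Set.Ioi (0 : ℝ), 1 / t ^ 2 * Real.log (1 + t ^ 2 * c ^ 2) = Real.pi * |c| := by
  rw [integral_Ioi_of_hasDerivAt_of_nonneg (continuousWithinAt_arctan_sub_log_div c)
    (fun _ ht => hasDerivAt_arctan_sub_log_div c ht) (fun t _ => log_one_add_sq_div_nonneg c t)
    (tendsto_arctan_sub_log_div c)]
  simp

/-- `det (1 + itA)` for Hermitian `A`. -/
theorem det_one_add_I_smul {V : Type*} [Fintype V] [DecidableEq V] {A : Matrix V V ℂ}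
    (hA : A.IsHermitian) {t : ℝ} (ht : 0 < t) :
    (1 + (Complex.I * t) • A).det = ∏ j, (1 + Complex.I * t * hA.eigenvalues j) := by
  have ht' : (t : ℂ) ≠ 0 := by exact_mod_cast ht.ne'
  -- Pulling out `-it` turns the determinant into the characteristic polynomial evaluated at `i/t`.
  have key : ∀ x : ℂ, 1 + Complex.I * t * x = -(Complex.I * t) * (Complex.I / t - x) := by
    intro x
    field_simp
    ring_nf
    simp [add_comm]
  have e : 1 + (Complex.I * t) • A
      = (-(Complex.I * t)) • (Matrix.scalar V (Complex.I / t) - A) := by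
    have h1 := key 0
    rw [mul_zero, add_zero, sub_zero] at h1
    rw [smul_sub, neg_smul _ A, sub_neg_eq_add, ← map_one (Matrix.scalar V), h1]
    congr 1
    ext i j
    by_cases h : i = j <;> simp [h]
  rw [e, Matrix.det_smul, ← Matrix.eval_charpoly, hA.charpoly_eq, Polynomial.eval_prod,
    ← Finset.card_univ, ← Finset.prod_const, ← Finset.prod_mul_distrib]
  refine Finset.prod_congr rfl fun j _ => ?_
  simp [key]

theorem normSq_det_one_add_I_smul {V : Type*} [Fintype V] [DecidableEq V] {A : Matrix V V ℂ}
    (hA : A.IsHermitian) {t : ℝ} (ht : 0 < t) :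
    Complex.normSq (1 + (Complex.I * t) • A).det = ∏ j, (1 + t ^ 2 * hA.eigenvalues j ^ 2) := by
  rw [det_one_add_I_smul hA ht, map_prod]
  refine Finset.prod_congr rfl fun j _ => ?_
  simp [Complex.normSq_apply]
  ring

open MeasureTheory in
/-- The Coulson-type integral formula for the energy of a gain graph. -/
theorem UnitGain.energy_eq_integral {V : Type*} [Fintype V] [DecidableEq V] {G : SimpleGraph V}
    (Φ : UnitGain G) (K : ℝ → ℝ)
    (hK : ∀ t : ℝ, 0 < t → K t = Complex.normSq (1 + (Complex.I * t) • Φ.adjMatrix).det) :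
    (∀ t : ℝ, 0 < t → 0 < K t) ∧
      IntegrableOn (fun t : ℝ => 1 / t ^ 2 * Real.log (K t)) (Set.Ioi 0) ∧
      Φ.energy = 1 / Real.pi * ∫ t in Set.Ioi (0 : ℝ), 1 / t ^ 2 * Real.log (K t) := by
  have hA := Φ.adjMatrix_isHermitian
  have hprod : ∀ t : ℝ, 0 < t → K t = ∏ j, (1 + t ^ 2 * hA.eigenvalues j ^ 2) := fun t ht => by
    rw [hK t ht, normSq_det_one_add_I_smul hA ht]
  have hlog : Set.EqOn (fun t : ℝ => ∑ j, 1 / t ^ 2 * Real.log (1 + t ^ 2 * hA.eigenvalues j ^ 2))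
      (fun t : ℝ => 1 / t ^ 2 * Real.log (K t)) (Set.Ioi 0) := fun t ht => by
    have ht' : 0 < t := ht
    simp only [hprod t ht']
    rw [Real.log_prod (fun j _ => by positivity), Finset.mul_sum]
  refine ⟨fun t ht => ?_, ?_, ?_⟩
  · rw [hprod t ht]
    exact Finset.prod_pos fun j _ => by positivity
  · refine IntegrableOn.congr_fun ?_ hlog measurableSet_Ioi
    exact integrable_finsetSum _ fun j _ => integrableOn_log_one_add_sq_div _
  · rw [← setIntegral_congr_fun measurableSet_Ioi hlog,
      integral_finsetSum _ fun j _ => integrableOn_log_one_add_sq_div _]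
    simp only [integral_log_one_add_sq_div]
    rw [← Finset.mul_sum, ← mul_assoc, one_div_mul_cancel Real.pi_ne_zero, one_mul]
    rfl

end GainDumbbell

/-! ### Determinants of tridiagonal and cyclic matrices. -/

namespace GainDumbbell

open Matrix

section Det

variable {R : Type*} [CommRing R]

/-- Expansion of a determinant along the first row and the first column. -/
theorem det_eq_sub_sum_adjugate {n : ℕ} (A : Matrix (Fin (n + 2)) (Fin (n + 2)) R) :
    A.det = A 0 0 * (A.submatrix Fin.succ Fin.succ).det
      - ∑ j : Fin (n + 1), ∑ i : Fin (n + 1),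
        A 0 j.succ * (A.submatrix Fin.succ Fin.succ).adjugate j i * A i.succ 0 := by
  rw [det_succ_row_zero, Fin.sum_univ_succ, sub_eq_add_neg, ← Finset.sum_neg_distrib]
  congr 1
  · simp
  refine Finset.sum_congr rfl fun j _ => ?_
  rw [det_succ_column_zero, Finset.mul_sum, ← Finset.sum_neg_distrib]
  refine Finset.sum_congr rfl fun i _ => ?_
  rw [adjugate_fin_succ_eq_det_submatrix, submatrix_submatrix, submatrix_submatrix]
  have e : (j.succ.succAbove ∘ Fin.succ : Fin n → Fin (n + 2)) = Fin.succ ∘ j.succAbove := by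
    funext k
    simp [Fin.succ_succAbove_succ]
  rw [e]
  simp only [submatrix_apply, Fin.succ_succAbove_zero, Fin.val_succ, pow_add, pow_one]
  ring

/-- Zero entries away from the diagonal and the two neighbouring diagonals. -/
def IsTridiagonal {n : ℕ} (A : Matrix (Fin n) (Fin n) R) : Prop :=
  ∀ i j : Fin n, i.val + 1 < j.val ∨ j.val + 1 < i.val → A i j = 0

theorem IsTridiagonal.submatrix_succ {n : ℕ} {A : Matrix (Fin (n + 1)) (Fin (n + 1)) R}
    (hA : IsTridiagonal A) : IsTridiagonal (A.submatrix Fin.succ Fin.succ) := fun i j h =>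
  hA _ _ (by simp only [Fin.val_succ]; omega)

/-- The continuant recurrence: index `0` has `1` as its only neighbour, so a single term of the
double sum survives. -/
theorem IsTridiagonal.det_eq {n : ℕ} {A : Matrix (Fin (n + 2)) (Fin (n + 2)) R}
    (hA : IsTridiagonal A) :
    A.det = A 0 0 * (A.submatrix Fin.succ Fin.succ).det - A 0 1 * A 1 0 *
      ((A.submatrix Fin.succ Fin.succ).submatrix Fin.succ Fin.succ).det := by
  rw [det_eq_sub_sum_adjugate, Finset.sum_eq_single 0, Finset.sum_eq_single 0]
  · rw [adjugate_fin_succ_eq_det_submatrix, Fin.succAbove_zero]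
    simp
    ring
  · intro i _ hi
    rw [hA i.succ 0, mul_zero]
    right
    have : i.val ≠ 0 := fun h => hi (Fin.ext h)
    simp only [Fin.val_succ, Fin.val_zero]
    omega
  · simp
  · intro j _ hj
    refine Finset.sum_eq_zero fun i _ => ?_
    rw [hA 0 j.succ, zero_mul, zero_mul]
    left
    have : j.val ≠ 0 := fun h => hj (Fin.ext h)
    simp only [Fin.val_succ, Fin.val_zero]
    omega
  · simp

/-- Opposite off-diagonal entries have product `-u`. -/
def HasOffProd {n : ℕ} (u : R) (A : Matrix (Fin n) (Fin n) R) : Prop :=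
  ∀ i j : Fin n, i.val + 1 = j.val → A i j * A j i = -u

theorem HasOffProd.submatrix_succ {n : ℕ} {u : R} {A : Matrix (Fin (n + 1)) (Fin (n + 1)) R}
    (hA : HasOffProd u A) : HasOffProd u (A.submatrix Fin.succ Fin.succ) := fun i j h =>
  hA _ _ (by simp only [Fin.val_succ]; omega)

/-- Deleting the last row and the first column leaves a lower triangular matrix whose diagonal is
the old superdiagonal. -/
theorem IsTridiagonal.adjugate_zero_last {n : ℕ} {A : Matrix (Fin (n + 1)) (Fin (n + 1)) R}
    (hA : IsTridiagonal A) :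
    A.adjugate 0 (Fin.last n) = (-1) ^ n * ∏ i : Fin n, A i.castSucc i.succ := by
  rw [adjugate_fin_succ_eq_det_submatrix, Fin.succAbove_last, Fin.succAbove_zero,
    det_of_isLowerTriangular]
  · simp
  · intro i j hij
    refine hA _ _ (Or.inl ?_)
    have : i.val < j.val := hij
    simp
    omega

theorem IsTridiagonal.adjugate_last_zero {n : ℕ} {A : Matrix (Fin (n + 1)) (Fin (n + 1)) R}
    (hA : IsTridiagonal A) :
    A.adjugate (Fin.last n) 0 = (-1) ^ n * ∏ i : Fin n, A i.succ i.castSucc := by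
  rw [adjugate_fin_succ_eq_det_submatrix, Fin.succAbove_last, Fin.succAbove_zero,
    det_of_isUpperTriangular]
  · simp
  · intro i j hij
    refine hA _ _ (Or.inr ?_)
    have : j.val < i.val := hij
    simp
    omega

/-- Unit diagonal, off-diagonal entries only along the cycle, with opposite entries having
product `-u`. -/
structure IsCyclic {m : ℕ} (u : R) (A : Matrix (Fin m) (Fin m) R) : Prop where
  diag : ∀ i, A i i = 1
  prod : ∀ i, A i (finRotate m i) * A (finRotate m i) i = -u
  zero : ∀ i j, i ≠ j → j ≠ finRotate m i → i ≠ finRotate m j → A i j = 0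

theorem finRotate_eq_iff {n : ℕ} (i j : Fin (n + 1)) :
    j = finRotate (n + 1) i ↔ j.val = i.val + 1 ∨ (i.val = n ∧ j.val = 0) := by
  rcases eq_or_ne i (Fin.last n) with rfl | h
  · rw [finRotate_last, Fin.ext_iff]
    simp
    omega
  · rw [Fin.ext_iff, coe_finRotate_of_ne_last h]
    have := Fin.val_ne_of_ne h
    simp at this
    omega

/-- Removing vertex `0` from a cycle leaves a path. -/
theorem IsCyclic.isTridiagonal {n : ℕ} {u : R} {A : Matrix (Fin (n + 1)) (Fin (n + 1)) R}
    (hA : IsCyclic u A) : IsTridiagonal (A.submatrix Fin.succ Fin.succ) := by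
  intro i j h
  refine hA.zero _ _ ?_ ?_ ?_
  · rw [Ne, Fin.ext_iff]; simp; omega
  · rw [Ne, finRotate_eq_iff]; simp; omega
  · rw [Ne, finRotate_eq_iff]; simp; omega

theorem IsCyclic.hasOffProd {n : ℕ} {u : R} {A : Matrix (Fin (n + 1)) (Fin (n + 1)) R}
    (hA : IsCyclic u A) : HasOffProd u (A.submatrix Fin.succ Fin.succ) := by
  intro i j h
  have e : j.succ = finRotate _ i.succ := by
    rw [finRotate_eq_iff]; simp; omega
  simp only [submatrix_apply]
  rw [e]
  exact hA.prod _

theorem prod_finRotate {n : ℕ} (F : Fin (n + 2) → Fin (n + 2) → R) :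
    ∏ i, F i (finRotate _ i)
      = F 0 1 * (∏ i : Fin n, F i.castSucc.succ i.succ.succ) * F (Fin.last _) 0 := by
  rw [Fin.prod_univ_castSucc, finRotate_last, Fin.prod_univ_succ]
  have e : ∀ i : Fin (n + 1), finRotate (n + 2) i.castSucc = i.succ := fun i => by
    rw [eq_comm, finRotate_eq_iff]
    simp
  simp only [e]
  rfl

variable [Algebra ℝ R]

/-- The value of `f_{k-1}` at `u`. -/
noncomputable def fval (u : R) (k : ℕ) : R := Polynomial.aeval u (fAux k)

theorem fval_zero (u : R) : fval u 0 = 0 := by simp [fval, fAux]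

theorem fval_one (u : R) : fval u 1 = 1 := by simp [fval, fAux]

theorem fval_add_two (u : R) (k : ℕ) : fval u (k + 2) = fval u (k + 1) + u * fval u k := by
  simp [fval, fAux]

/-- A path whose last diagonal entry is `1 + w`. -/
theorem det_path_last (u w : R) : ∀ (n : ℕ) (A : Matrix (Fin n) (Fin n) R), IsTridiagonal A →
    HasOffProd u A → (∀ i : Fin n, A i i = 1 + if i.val + 1 = n then w else 0) →
    A.det = fval u (n + 1) + w * fval u n
  | 0, A, _, _, _ => by simp [fval_zero, fval_one]
  | 1, A, _, _, hd => by
    rw [det_fin_one, hd]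
    simp [fval_add_two, fval_zero, fval_one]
  | n + 2, A, ht, ho, hd => by
    have hd1 : ∀ i, (A.submatrix Fin.succ Fin.succ) i i = 1 + if i.val + 1 = n + 1 then w else 0 :=
      fun i => by simp [hd]
    have hd2 : ∀ i, ((A.submatrix Fin.succ Fin.succ).submatrix Fin.succ Fin.succ) i i
        = 1 + if i.val + 1 = n then w else 0 := fun i => by simp [hd]
    rw [ht.det_eq, det_path_last u w (n + 1) _ ht.submatrix_succ ho.submatrix_succ hd1,
      det_path_last u w n _ ht.submatrix_succ.submatrix_succ ho.submatrix_succ.submatrix_succ hd2,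
      ho 0 1 (by simp), hd, fval_add_two u (n + 1), fval_add_two u n]
    simp
    ring

/-- A path whose end diagonal entries are `1 + x` and `1 + w`. -/
theorem det_path_ends (u x w : R) (n : ℕ) (A : Matrix (Fin (n + 1)) (Fin (n + 1)) R)
    (ht : IsTridiagonal A) (ho : HasOffProd u A)
    (hd : ∀ i : Fin (n + 1), A i i
      = 1 + (if i.val = 0 then x else 0) + if i.val = n then w else 0) :
    A.det = fval u (n + 2) + x * fval u (n + 1) + w * (fval u (n + 1) + x * fval u n) := by
  -- For `n = 0` the single vertex is both ends and carries both perturbations.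
  rcases n with _ | n
  · rw [det_fin_one, hd]
    simp [fval_add_two, fval_zero, fval_one]
  · have hd1 : ∀ i, (A.submatrix Fin.succ Fin.succ) i i = 1 + if i.val + 1 = n + 1 then w else 0 :=
      fun i => by simp [hd]
    have hd2 : ∀ i, ((A.submatrix Fin.succ Fin.succ).submatrix Fin.succ Fin.succ) i i
        = 1 + if i.val + 1 = n then w else 0 := fun i => by simp [hd]
    rw [ht.det_eq, det_path_last u w (n + 1) _ ht.submatrix_succ ho.submatrix_succ hd1,
      det_path_last u w n _ ht.submatrix_succ.submatrix_succ ho.submatrix_succ.submatrix_succ hd2,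
      ho 0 1 (by simp), hd, fval_add_two u (n + 1), fval_add_two u n]
    simp
    ring

theorem det_path (u : R) {n : ℕ} {A : Matrix (Fin n) (Fin n) R} (ht : IsTridiagonal A)
    (ho : HasOffProd u A) (hd : ∀ i : Fin n, A i i = 1) : A.det = fval u (n + 1) := by
  rw [det_path_last u 0 n A ht ho fun i => by simp [hd], zero_mul, add_zero]

theorem IsCyclic.adjugate_zero_zero {n : ℕ} {u : R} {A : Matrix (Fin (n + 1)) (Fin (n + 1)) R}
    (hA : IsCyclic u A) : A.adjugate 0 0 = fval u (n + 1) := by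
  rw [adjugate_fin_succ_eq_det_submatrix, Fin.succAbove_zero,
    det_path u hA.isTridiagonal hA.hasOffProd fun i => hA.diag _]
  simp

/-- Vertex `0` has two neighbours, the ends of the path that remains without it. In the expansion
along row and column `0`, returning by the same edge gives `u f_{n+1}` twice. Leaving by one edge
and returning by the other gives the product around the cycle, once per orientation, through the
corner entries of the adjugate of the path. -/
theorem IsCyclic.det_eq {n : ℕ} {u : R} {A : Matrix (Fin (n + 3)) (Fin (n + 3)) R}
    (hA : IsCyclic u A) :
    A.det = fval u (n + 4) + u * fval u (n + 2)
      + (-1) ^ n * (∏ i, A i (finRotate _ i) + ∏ i, A (finRotate _ i) i) := by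
  have ht := hA.isTridiagonal
  have ho := hA.hasOffProd
  set P := A.submatrix Fin.succ Fin.succ with hP
  have hPd : ∀ i, P i i = 1 := fun i => hA.diag _
  have hl0 : Fin.last (n + 1) ≠ 0 := by simp [Fin.ext_iff]
  have z1 : ∀ j : Fin (n + 2), j ≠ 0 → j ≠ Fin.last (n + 1) → A 0 j.succ = 0 ∧ A j.succ 0 = 0 := by
    intro j h0 h1
    have h0' := Fin.val_ne_of_ne h0
    have h1' := Fin.val_ne_of_ne h1
    simp at h0' h1'
    have a1 : (0 : Fin (n + 3)) ≠ j.succ := by rw [Ne, Fin.ext_iff]; simp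
    have a2 : j.succ ≠ finRotate (n + 3) 0 := by rw [Ne, finRotate_eq_iff]; simp; omega
    have a3 : 0 ≠ finRotate (n + 3) j.succ := by rw [Ne, finRotate_eq_iff]; simp; omega
    exact ⟨hA.zero _ _ a1 a2 a3, hA.zero _ _ a1.symm a3 a2⟩
  have e0 : finRotate (n + 3) 0 = 1 := by
    rw [eq_comm, finRotate_eq_iff]; simp
  have q0 : A 0 1 * A 1 0 = -u := by
    have := hA.prod 0
    rwa [e0] at this
  have q1 : A (Fin.last _) 0 * A 0 (Fin.last _) = -u := by
    have := hA.prod (Fin.last _)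
    rwa [finRotate_last] at this
  have c00 : P.adjugate 0 0 = fval u (n + 2) := by
    rw [adjugate_fin_succ_eq_det_submatrix, Fin.succAbove_zero,
      det_path u ht.submatrix_succ ho.submatrix_succ fun i => hPd _]
    simp
  have cll : P.adjugate (Fin.last _) (Fin.last _) = fval u (n + 2) := by
    rw [adjugate_fin_succ_eq_det_submatrix, Fin.succAbove_last,
      det_path u (A := P.submatrix Fin.castSucc Fin.castSucc) (fun i j h => ht _ _ h)
        (fun i j h => ho _ _ h) fun i => hPd _]
    simp
  have c0l := ht.adjugate_zero_last
  have cl0 := ht.adjugate_last_zero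
  rw [prod_finRotate A, prod_finRotate fun i j => A j i, det_eq_sub_sum_adjugate, ← hP,
    det_path u ht ho hPd,
    Finset.sum_eq_add 0 (Fin.last _) hl0.symm (fun j _ hj => Finset.sum_eq_zero fun i _ => by
      rw [(z1 j hj.1 hj.2).1, zero_mul, zero_mul]) (by simp) (by simp),
    Finset.sum_eq_add 0 (Fin.last _) hl0.symm (fun i _ hi => by
      rw [(z1 i hi.1 hi.2).2, mul_zero]) (by simp) (by simp),
    Finset.sum_eq_add 0 (Fin.last _) hl0.symm (fun i _ hi => by
      rw [(z1 i hi.1 hi.2).2, mul_zero]) (by simp) (by simp),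
    c00, cll, c0l, cl0, hA.diag, fval_add_two u (n + 2)]
  simp only [hP, submatrix_apply, Fin.succ_zero_eq_one, Fin.succ_last, Fin.succ_castSucc]
  linear_combination (-fval u (n + 2)) * q0 - fval u (n + 2) * q1

end Det

/-- A block matrix whose off-diagonal blocks have one nonzero entry each. -/
theorem det_of_single_coupling {m n : Type*} [Fintype m] [Fintype n] [DecidableEq m]
    [DecidableEq n] {F : Type*} [Field F] (M : Matrix (m ⊕ n) (m ⊕ n) F) (i : m) (j : n)
    (h12 : ∀ i' j', ¬ (i' = i ∧ j' = j) → M (.inl i') (.inr j') = 0)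
    (h21 : ∀ i' j', ¬ (i' = i ∧ j' = j) → M (.inr j') (.inl i') = 0)
    (hdet : M.toBlocks₁₁.det ≠ 0) :
    M.det = M.toBlocks₁₁.det * (M.toBlocks₂₂ - Matrix.single j j
      (M (.inl i) (.inr j) * M (.inr j) (.inl i) *
        (M.toBlocks₁₁.adjugate i i / M.toBlocks₁₁.det))).det := by
  have hu : IsUnit M.toBlocks₁₁.det := hdet.isUnit
  let _ := Matrix.invertibleOfIsUnitDet _ hu
  have e12 : M.toBlocks₁₂ = Matrix.single i j (M (.inl i) (.inr j)) := by
    ext i' j'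
    rw [single_apply]
    split_ifs with h
    · rw [← h.1, ← h.2]; rfl
    · exact h12 _ _ fun h' => h ⟨h'.1.symm, h'.2.symm⟩
  have e21 : M.toBlocks₂₁ = Matrix.single j i (M (.inr j) (.inl i)) := by
    ext j' i'
    rw [single_apply]
    split_ifs with h
    · rw [← h.1, ← h.2]; rfl
    · exact h21 _ _ fun h' => h ⟨h'.2.symm, h'.1.symm⟩
  conv_lhs => rw [← fromBlocks_toBlocks M]
  -- In the Schur complement, the inverse block stands between two single-entry matrices, so only
  -- its `(i, i)` entry, adjugate over determinant, remains.
  rw [det_fromBlocks₁₁, e12, e21, single_mul_mul_single, invOf_eq_nonsing_inv, inv_def]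
  congr 4
  rw [Matrix.smul_apply, Ring.inverse_eq_inv', smul_eq_mul]
  ring

end GainDumbbell

/-! ### The polynomial identity and the sign. -/

namespace GainDumbbell

open Matrix Polynomial

theorem f_eq_fAux {j : ℤ} (k : ℕ) (h : j + 1 = k) : f j = fAux k := by
  rw [f, h, Int.toNat_natCast]

theorem g_eq_fAux (m : ℕ) : g (m + 1 : ℕ) = fAux (m + 2) + X * fAux m := by
  rw [g, f_eq_fAux (m + 2) (by push_cast; ring), f_eq_fAux m (by push_cast; ring)]

theorem eval_fAux_nonneg_and_pos {x : ℝ} (hx : 0 ≤ x) :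
    ∀ k, 0 ≤ (fAux k).eval x ∧ 0 < (fAux (k + 1)).eval x
  | 0 => by simp [fAux]
  | k + 1 => by
    obtain ⟨h0, h1⟩ := eval_fAux_nonneg_and_pos hx k
    refine ⟨h1.le, ?_⟩
    simp only [fAux, eval_add, eval_mul, eval_X]
    positivity

theorem eval_g_pos {x : ℝ} (hx : 0 ≤ x) {m : ℕ} (hm : 1 ≤ m) : 0 < (g m).eval x := by
  obtain ⟨k, rfl⟩ : ∃ k, m = k + 1 := ⟨m - 1, by omega⟩
  rw [g_eq_fAux]
  simp only [eval_add, eval_mul, eval_X]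
  exact add_pos_of_pos_of_nonneg (eval_fAux_nonneg_and_pos hx (k + 1)).2
    (mul_nonneg hx (eval_fAux_nonneg_and_pos hx k).1)

/-- The one-step matrix of the recurrence has determinant `-X`, so each step multiplies the left
side by `-X`. -/
theorem fAux_cassini (n : ℕ) : fAux (n + 1) ^ 2 - fAux (n + 2) * fAux n = (-1) ^ n * X ^ n := by
  induction n with
  | zero => simp [fAux]
  | succ n ih =>
    have h1 : fAux (n + 3) = fAux (n + 2) + X * fAux (n + 1) := rfl
    have h2 : fAux (n + 2) = fAux (n + 1) + X * fAux n := rfl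
    rw [h1, pow_succ, pow_succ]
    linear_combination (-X) * ih + fAux (n + 2) * h2

/-- All terms containing `g_r` or `g_s` cancel. For `ℓ ≥ 2` there remains `u² f_{r-1} f_{s-1}
(f_{ℓ-2}² - f_{ℓ-1} f_{ℓ-3})`, to which Cassini applies. -/
theorem polyR_mul_polyS_sub (r s ℓ : ℕ) (hℓ : 1 ≤ ℓ) :
    polyR s ℓ * polyS r ℓ - polyM r s ℓ * polyT ℓ
      = (-1) ^ ℓ * X ^ ℓ * f (r - 1) * f (s - 1) := by
  obtain rfl | ⟨n, rfl⟩ : ℓ = 1 ∨ ∃ n, ℓ = n + 2 := by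
    rcases eq_or_ne ℓ 1 with h | h
    · exact Or.inl h
    · exact Or.inr ⟨ℓ - 2, by omega⟩
  · simp only [polyR, polyS, polyM, polyT, if_true]
    rw [f_eq_fAux (j := ((1 : ℕ) : ℤ) - 1) 1 (by simp), f_eq_fAux (j := ((1 : ℕ) : ℤ) - 2) 0 (by simp)]
    simp only [fAux]
    ring
  · simp only [polyR, polyS, polyM, polyT, if_neg (show n + 2 ≠ 1 by omega)]
    rw [f_eq_fAux (j := ((n + 2 : ℕ) : ℤ) - 1) (n + 2) (by push_cast; ring),
      f_eq_fAux (j := ((n + 2 : ℕ) : ℤ) - 2) (n + 1) (by push_cast; ring),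
      f_eq_fAux (j := ((n + 2 : ℕ) : ℤ) - 3) n (by push_cast; ring), pow_add, pow_add]
    linear_combination X ^ 2 * f (r - 1) * f (s - 1) * fAux_cassini n

theorem sign_kernel (r s ℓ : ℕ) (hr : 1 ≤ r) (hs : 1 ≤ s) (hℓ : 1 ≤ ℓ) {t : ℝ} (ht : 0 < t) :
    Real.sign (kerX r s ℓ t * kerY r s ℓ t - kerZ r s ℓ t * kerW r s ℓ t) = (-1) ^ ℓ := by
  have h := congrArg (eval (t ^ 2)) (polyR_mul_polyS_sub r s ℓ hℓ)
  have hf : ∀ m : ℕ, 1 ≤ m → 0 < (f (m - 1)).eval (t ^ 2) := fun m hm => by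
    rw [f_eq_fAux m (by ring)]
    obtain ⟨k, rfl⟩ : ∃ k, m = k + 1 := ⟨m - 1, by omega⟩
    exact (eval_fAux_nonneg_and_pos (sq_nonneg t) k).2
  simp only [eval_sub, eval_mul, eval_pow, eval_neg, eval_one, eval_X] at h
  have e : kerX r s ℓ t * kerY r s ℓ t - kerZ r s ℓ t * kerW r s ℓ t
      = (-1) ^ ℓ * (4 * t ^ (r + s) * (t ^ 2) ^ ℓ *
        ((f (r - 1)).eval (t ^ 2) * (f (s - 1)).eval (t ^ 2))) := by
    simp only [kerX, kerY, kerZ, kerW, pow_add]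
    linear_combination 4 * t ^ r * t ^ s * h
  have hp : 0 < 4 * t ^ (r + s) * (t ^ 2) ^ ℓ *
      ((f (r - 1)).eval (t ^ 2) * (f (s - 1)).eval (t ^ 2)) := by
    have := hf r hr
    have := hf s hs
    positivity
  rw [e]
  rcases neg_one_pow_eq_or ℝ ℓ with h1 | h1 <;> rw [h1]
  · rw [one_mul, Real.sign_of_pos hp]
  · rw [neg_one_mul, Real.sign_of_neg (neg_lt_zero.2 hp)]

theorem fval_ofReal (x : ℝ) (k : ℕ) : fval (x : ℂ) k = ((fAux k).eval x : ℝ) := by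
  rw [fval]
  exact aeval_algebraMap_apply_eq_algebraMap_eval x (fAux k)

/-- The determinant is linear in row `i`. -/
theorem det_sub_single {n R : Type*} [Fintype n] [DecidableEq n] [CommRing R] (A : Matrix n n R)
    (i : n) (v : R) : (A - Matrix.single i i v).det = A.det - v * A.adjugate i i := by
  have e : A - Matrix.single i i v = A.updateRow i (A i + (-v) • Pi.single i 1) := by
    ext a b
    rcases eq_or_ne a i with rfl | h
    · by_cases hb : b = a
      · subst hb; simp [sub_eq_add_neg]
      · simp [hb, Ne.symm hb]
    · simp [h, Ne.symm h]
  rw [e, det_updateRow_add, det_updateRow_smul, updateRow_eq_self, adjugate_apply]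
  ring

theorem cycleGraph_adj_imp {m : ℕ} {i j : Fin m} (h : (SimpleGraph.cycleGraph m).Adj i j) :
    j = finRotate m i ∨ i = finRotate m j := by
  rcases m with _ | _ | n
  · exact i.elim0
  · exact absurd (Subsingleton.elim (α := Fin 1) i j) h.ne
  · rw [SimpleGraph.cycleGraph_adj] at h
    rw [finRotate_apply, finRotate_apply]
    rcases h with h | h
    · right; rw [← h]; abel
    · left; rw [← h]; abel

/-! ### The matrix `1 + itA` and its restriction to an odd cycle. -/

namespace UnitGain

variable {V : Type*} [DecidableEq V] {G : SimpleGraph V} (Φ : UnitGain G) (t : ℝ)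

/-- The matrix `1 + itA`. -/
noncomputable def shifted : Matrix V V ℂ := 1 + (Complex.I * t) • Φ.adjMatrix

theorem shifted_self (v : V) : Φ.shifted t v v = 1 := by
  simp [shifted, adjMatrix]

theorem shifted_of_not_adj {v w : V} (hne : v ≠ w) (h : ¬ G.Adj v w) : Φ.shifted t v w = 0 := by
  simp [shifted, adjMatrix, hne, h]

theorem shifted_of_adj {v w : V} (h : G.Adj v w) :
    Φ.shifted t v w = Complex.I * t * Φ.gain ⟨(v, w), h⟩ := by
  simp [shifted, adjMatrix, h.ne, h]

theorem shifted_of_adj' {v w : V} (h : G.Adj v w) :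
    Φ.shifted t w v = Complex.I * t * (starRingEnd ℂ) (Φ.gain ⟨(v, w), h⟩ : ℂ) := by
  rw [Φ.shifted_of_adj t h.symm, ← Circle.coe_inv_eq_conj, ← Φ.gain_symm]
  rfl

/-- Opposite gains are conjugate of modulus one and cancel, leaving `(it)²`; this is why the
polynomials are evaluated at `u = t²`. -/
theorem shifted_mul_of_adj {v w : V} (h : G.Adj v w) :
    Φ.shifted t v w * Φ.shifted t w v = -((t ^ 2 : ℝ) : ℂ) := by
  rw [Φ.shifted_of_adj t h, Φ.shifted_of_adj' t h]
  have h1 : (Φ.gain ⟨(v, w), h⟩ : ℂ) * (starRingEnd ℂ) (Φ.gain ⟨(v, w), h⟩ : ℂ) = 1 := by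
    rw [Complex.mul_conj]
    simp
  push_cast
  linear_combination (Complex.I ^ 2 * (t : ℂ) ^ 2) * h1 + (t : ℂ) ^ 2 * Complex.I_sq

/-- An induced cycle gives a cyclic principal submatrix. -/
theorem isCyclic_submatrix {m : ℕ} (c : Fin m → V) (hinj : Function.Injective c)
    (hc : ∀ i, G.Adj (c i) (c (finRotate m i)))
    (hc' : ∀ i j, G.Adj (c i) (c j) → (SimpleGraph.cycleGraph m).Adj i j) :
    IsCyclic (((t ^ 2 : ℝ) : ℂ)) ((Φ.shifted t).submatrix c c) where
  diag _ := Φ.shifted_self t _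
  prod i := Φ.shifted_mul_of_adj t (hc i)
  zero i j h h1 h2 := Φ.shifted_of_not_adj t (hinj.ne h) fun h3 =>
    (cycleGraph_adj_imp (hc' i j h3)).elim h1 h2

/-- The two orientations of the cycle have conjugate gains, so their sum is `2 Re γ` times `(it)^m`,
which is purely imaginary because `m` is odd. -/
theorem det_submatrix_cycle {m : ℕ} (hm : 3 ≤ m) (hodd : Odd m) (c : Fin m → V)
    (hinj : Function.Injective c) (hc : ∀ i, G.Adj (c i) (c (finRotate m i)))
    (hc' : ∀ i j, G.Adj (c i) (c j) → (SimpleGraph.cycleGraph m).Adj i j) :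
    ((Φ.shifted t).submatrix c c).det = (((g m).eval (t ^ 2) : ℝ) : ℂ)
      - 2 * Complex.I * ((delta m * (Φ.cycleGain c hc : ℂ).re * t ^ m : ℝ) : ℂ) := by
  obtain ⟨n, rfl⟩ : ∃ n, m = n + 3 := ⟨m - 3, by omega⟩
  have hn : Even n := by
    obtain ⟨k, hk⟩ := hodd
    exact ⟨k - 1, by omega⟩
  rw [(Φ.isCyclic_submatrix t c hinj hc hc').det_eq, hn.neg_one_pow, one_mul]
  have e1 : ∏ i, (Φ.shifted t).submatrix c c i (finRotate _ i)
      = (Complex.I * t) ^ (n + 3) * (Φ.cycleGain c hc : ℂ) := by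
    simp only [submatrix_apply, fun i => Φ.shifted_of_adj t (hc i), Finset.prod_mul_distrib,
      Finset.prod_const, Finset.card_univ, Fintype.card_fin, cycleGain, ← mul_pow]
    congr 1
    exact (map_prod Circle.coeHom _ _).symm
  have e2 : ∏ i, (Φ.shifted t).submatrix c c (finRotate _ i) i
      = (Complex.I * t) ^ (n + 3) * (starRingEnd ℂ) (Φ.cycleGain c hc : ℂ) := by
    simp only [submatrix_apply, fun i => Φ.shifted_of_adj' t (hc i), Finset.prod_mul_distrib,
      Finset.prod_const, Finset.card_univ, Fintype.card_fin, cycleGain, ← mul_pow]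
    congr 1
    rw [← map_prod]
    congr 1
    exact (map_prod Circle.coeHom _ _).symm
  -- The sign `δ_m` is what `i^m` leaves after extracting `-i`.
  have hI : Complex.I ^ (n + 3) = -Complex.I * ((delta (n + 3) : ℝ) : ℂ) := by
    obtain ⟨k, hk⟩ := hodd
    rw [delta, hk, show (2 * k + 1 + 1) / 2 = k + 1 by omega, pow_succ, pow_mul, Complex.I_sq]
    push_cast
    ring
  rw [e1, e2, ← mul_add, Complex.add_conj, mul_pow, hI, g_eq_fAux (n + 2), fval_ofReal,
    fval_ofReal]
  simp only [eval_add, eval_mul, eval_X]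
  push_cast
  ring

end UnitGain

theorem IsCyclic.adjugate_of_val_eq_zero {m : ℕ} {u : ℂ} {A : Matrix (Fin m) (Fin m) ℂ}
    (hA : IsCyclic u A) (i : Fin m) (hi : i.val = 0) : A.adjugate i i = fval u m := by
  rcases m with _ | n
  · exact i.elim0
  · obtain rfl : i = 0 := Fin.ext hi
    exact hA.adjugate_zero_zero

/-! ### The determinant of the dumbbell. -/

section Dumbbell

variable {r s ℓ : ℕ}

/-- `det (1 + itA)` for the cycle `C_m` in terms of `δ_m Re γ_m`. -/
noncomputable def cycleDet (m : ℕ) (a t : ℝ) : ℂ :=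
  (((g m).eval (t ^ 2) : ℝ) : ℂ) - 2 * Complex.I * ((a * t ^ m : ℝ) : ℂ)

/-- The real part `g_m(t²)` is positive; this licenses the division by the cycle block in the Schur
complements. -/
theorem cycleDet_ne_zero {m : ℕ} (hm : 1 ≤ m) (a t : ℝ) : cycleDet m a t ≠ 0 := by
  intro h
  have h1 := congrArg Complex.re h
  have h2 := eval_g_pos (sq_nonneg t) hm
  simp only [cycleDet, mul_comm (2 : ℂ), mul_assoc, Complex.sub_re, Complex.ofReal_re,
    Complex.I_mul_re, Complex.mul_im, Complex.ofReal_im, Complex.im_ofNat, Complex.zero_re] at h1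
  linarith

theorem det_toBlocks₁₁_of_isEmpty {m n R : Type*} [Fintype m] [Fintype n] [DecidableEq m]
    [DecidableEq n] [IsEmpty n] [CommRing R] (M : Matrix (m ⊕ n) (m ⊕ n) R) :
    M.det = M.toBlocks₁₁.det := by
  conv_lhs => rw [← fromBlocks_toBlocks M]
  rw [Subsingleton.elim M.toBlocks₂₁ 0, det_fromBlocks_zero₂₁, det_isEmpty (A := M.toBlocks₂₂),
    mul_one]

variable (Φ : UnitGain (dumbbell r s ℓ)) (t : ℝ)

theorem isCyclic_left (hr : 3 ≤ r) :
    IsCyclic (((t ^ 2 : ℝ) : ℂ)) (Φ.shifted t).toBlocks₁₁ :=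
  Φ.isCyclic_submatrix t (fun i : Fin r => .inl i) Sum.inl_injective (dumbbell_adj_left hr s ℓ)
    fun _ _ h => h

theorem isCyclic_right (hs : 3 ≤ s) :
    IsCyclic (((t ^ 2 : ℝ) : ℂ)) (Φ.shifted t).toBlocks₂₂.toBlocks₁₁ :=
  Φ.isCyclic_submatrix t (fun i : Fin s => .inr (.inl i))
    (Sum.inr_injective.comp Sum.inl_injective) (dumbbell_adj_right r hs ℓ) fun _ _ h => h

theorem det_left (hr : 3 ≤ r) (hodd : Odd r) :
    (Φ.shifted t).toBlocks₁₁.det = cycleDet r (alpha hr Φ) t :=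
  Φ.det_submatrix_cycle t hr hodd (fun i : Fin r => .inl i) Sum.inl_injective
    (dumbbell_adj_left hr s ℓ) fun _ _ h => h

theorem det_right (hs : 3 ≤ s) (hodd : Odd s) :
    (Φ.shifted t).toBlocks₂₂.toBlocks₁₁.det = cycleDet s (beta hs Φ) t :=
  Φ.det_submatrix_cycle t hs hodd (fun i : Fin s => .inr (.inl i))
    (Sum.inr_injective.comp Sum.inl_injective) (dumbbell_adj_right r hs ℓ) fun _ _ h => h

theorem det_shifted_of_bridge (hr : 3 ≤ r) (hs : 3 ≤ s) (hr_odd : Odd r) (hs_odd : Odd s)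
    (Φ : UnitGain (dumbbell r s 1)) :
    (Φ.shifted t).det = cycleDet r (alpha hr Φ) t * cycleDet s (beta hs Φ) t
      + ((t ^ 2 : ℝ) : ℂ) * fval ((t ^ 2 : ℝ) : ℂ) r * fval ((t ^ 2 : ℝ) : ℂ) s := by
  have hc := cycleDet_ne_zero (show 1 ≤ r by omega) (alpha hr Φ) t
  have hadj : (dumbbell r s 1).Adj (.inl ⟨0, by omega⟩) (.inr (.inl ⟨0, by omega⟩)) :=
    ⟨rfl, rfl, rfl⟩
  rw [det_of_single_coupling (Φ.shifted t) ⟨0, by omega⟩ (.inl ⟨0, by omega⟩),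
    Φ.shifted_mul_of_adj t hadj, (isCyclic_left Φ t hr).adjugate_of_val_eq_zero _ rfl,
    det_left Φ t hr hr_odd]
  rotate_left
  · rintro i (j | j) h
    · refine Φ.shifted_of_not_adj t (by simp) fun h' => h ⟨Fin.ext h'.2.1, ?_⟩
      exact congrArg Sum.inl (Fin.ext h'.2.2)
    · exact j.elim0
  · rintro i (j | j) h
    · refine Φ.shifted_of_not_adj t (by simp) fun h' => h ⟨Fin.ext h'.2.1, ?_⟩
      exact congrArg Sum.inl (Fin.ext h'.2.2)
    · exact j.elim0
  · rwa [det_left Φ t hr hr_odd]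
  -- For `ℓ = 1` the path has no interior vertices, so only the second cycle remains.
  rw [det_toBlocks₁₁_of_isEmpty (n := Fin 0)]
  have e : ∀ v : ℂ, ((Φ.shifted t).toBlocks₂₂ - Matrix.single
      (Sum.inl (⟨0, by omega⟩ : Fin s) : Fin s ⊕ Fin (1 - 1))
      (Sum.inl (⟨0, by omega⟩ : Fin s)) v).toBlocks₁₁
      = (Φ.shifted t).toBlocks₂₂.toBlocks₁₁ - Matrix.single ⟨0, by omega⟩ ⟨0, by omega⟩ v := by
    intro v
    ext a b
    simp [toBlocks₁₁, toBlocks₂₂, single_apply]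
  rw [e, det_sub_single, det_right Φ t hs hs_odd,
    (isCyclic_right Φ t hs).adjugate_of_val_eq_zero _ rfl]
  field_simp
  ring

/-- Both cycles are eliminated, which adds `u f_{r-1}` and `u f_{s-1}`, each divided by its cycle
determinant, to the end entries of the interior path. Multiplying back by the two cycle determinants
clears the denominators. -/
theorem det_shifted_of_path {n : ℕ} (hr : 3 ≤ r) (hs : 3 ≤ s) (hr_odd : Odd r) (hs_odd : Odd s)
    (Φ : UnitGain (dumbbell r s (n + 2))) (u : ℂ) (hu : u = ((t ^ 2 : ℝ) : ℂ)) :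
    (Φ.shifted t).det
      = fval u (n + 2) * cycleDet r (alpha hr Φ) t * cycleDet s (beta hs Φ) t
        + u * fval u (n + 1) * (fval u r * cycleDet s (beta hs Φ) t
          + fval u s * cycleDet r (alpha hr Φ) t)
        + u ^ 2 * fval u n * fval u r * fval u s := by
  have hcr := cycleDet_ne_zero (show 1 ≤ r by omega) (alpha hr Φ) t
  have hcs := cycleDet_ne_zero (show 1 ≤ s by omega) (beta hs Φ) t
  have hadj1 : (dumbbell r s (n + 2)).Adj (.inl ⟨0, by omega⟩) (.inr (.inr (0 : Fin (n + 1)))) :=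
    ⟨rfl, rfl⟩
  have hadj2 : (dumbbell r s (n + 2)).Adj (.inr (.inl ⟨0, by omega⟩))
      (.inr (.inr (Fin.last n))) := ⟨rfl, rfl⟩
  rw [det_of_single_coupling (Φ.shifted t) ⟨0, by omega⟩ (.inr (0 : Fin (n + 1))),
    Φ.shifted_mul_of_adj t hadj1, (isCyclic_left Φ t hr).adjugate_of_val_eq_zero _ rfl,
    det_left Φ t hr hr_odd, ← hu]
  rotate_left
  · rintro i (j | j) h
    · exact Φ.shifted_of_not_adj t (by simp) fun h' => absurd h'.1 (by omega)
    · refine Φ.shifted_of_not_adj t (by simp) fun h' => h ⟨Fin.ext h'.1, ?_⟩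
      exact congrArg Sum.inr (Fin.ext h'.2)
  · rintro i (j | j) h
    · exact Φ.shifted_of_not_adj t (by simp) fun h' => absurd h'.1 (by omega)
    · refine Φ.shifted_of_not_adj t (by simp) fun h' => h ⟨Fin.ext h'.1, ?_⟩
      exact congrArg Sum.inr (Fin.ext h'.2)
  · rwa [det_left Φ t hr hr_odd]
  set v := -u * (fval u r / cycleDet r (alpha hr Φ) t) with hv
  set M : Matrix (Fin s ⊕ Fin (n + 1)) (Fin s ⊕ Fin (n + 1)) ℂ :=
    (Φ.shifted t).toBlocks₂₂ - Matrix.single (.inr (0 : Fin (n + 1))) (.inr (0 : Fin (n + 1))) v with hM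
  have e11 : M.toBlocks₁₁ = (Φ.shifted t).toBlocks₂₂.toBlocks₁₁ := by
    ext a b
    simp [hM, toBlocks₁₁, toBlocks₂₂]
  have e12 : ∀ i j, M (.inl i) (.inr j) = Φ.shifted t (.inr (.inl i)) (.inr (.inr j)) := by
    intro i j
    simp [hM, toBlocks₂₂]
  have e21 : ∀ i j, M (.inr j) (.inl i) = Φ.shifted t (.inr (.inr j)) (.inr (.inl i)) := by
    intro i j
    simp [hM, toBlocks₂₂]
  rw [det_of_single_coupling M ⟨0, by omega⟩ (Fin.last n), e12, e21,
    Φ.shifted_mul_of_adj t hadj2, e11, (isCyclic_right Φ t hs).adjugate_of_val_eq_zero _ rfl,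
    det_right Φ t hs hs_odd, ← hu]
  rotate_left
  · intro i j h
    rw [e12]
    refine Φ.shifted_of_not_adj t (by simp) fun h' => h ⟨Fin.ext h'.1, Fin.ext ?_⟩
    simpa using h'.2
  · intro i j h
    rw [e21]
    refine Φ.shifted_of_not_adj t (by simp) fun h' => h ⟨Fin.ext h'.1, Fin.ext ?_⟩
    simpa using h'.2
  · rwa [e11, det_right Φ t hs hs_odd]
  set w := -u * (fval u s / cycleDet s (beta hs Φ) t) with hw
  -- The two corrections are kept as separate summands because the path ends coincide when `n = 0`.
  have hP : ∀ i j, (M.toBlocks₂₂ - Matrix.single (Fin.last n) (Fin.last n) w) i j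
      = Φ.shifted t (.inr (.inr i)) (.inr (.inr j)) - (if 0 = i ∧ 0 = j then v else 0)
        - if Fin.last n = i ∧ Fin.last n = j then w else 0 := by
    intro i j
    simp [hM, toBlocks₂₂, single_apply]
  have hne : ∀ i j : Fin (n + 1), i ≠ j →
      (M.toBlocks₂₂ - Matrix.single (Fin.last n) (Fin.last n) w) i j
      = Φ.shifted t (.inr (.inr i)) (.inr (.inr j)) := by
    intro i j h
    rw [hP, if_neg fun h' => h (h'.1.symm.trans h'.2), if_neg fun h' => h (h'.1.symm.trans h'.2)]
    simp
  rw [det_path_ends u (-v) (-w) n]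
  · rw [hv, hw]
    field_simp
    ring
  · intro i j h
    have hij : i ≠ j := fun h' => by subst h'; omega
    rw [hne i j hij]
    refine Φ.shifted_of_not_adj t (by simpa using hij) fun h' => ?_
    have := SimpleGraph.pathGraph_adj.1 h'
    omega
  · intro i j h
    have hij : i ≠ j := fun h' => by subst h'; omega
    rw [hne i j hij, hne j i hij.symm, hu]
    exact Φ.shifted_mul_of_adj t (v := .inr (.inr i)) (w := .inr (.inr j))
      (SimpleGraph.pathGraph_adj.2 (Or.inl h))
  · intro i
    rw [hP, Φ.shifted_self]
    have h1 : (0 = i ∧ 0 = i) ↔ i.val = 0 := by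
      rw [and_self, eq_comm, Fin.ext_iff]; rfl
    have h2 : (Fin.last n = i ∧ Fin.last n = i) ↔ i.val = n := by
      rw [and_self, eq_comm, Fin.ext_iff]; rfl
    simp only [h1, h2]
    split_ifs <;> ring

/-- The product of the two cycle determinants supplies `-4αβ t^{r+s}` to the real part through `i² =
-1`; terms with one cycle determinant or none are expanded directly. -/
theorem det_shifted_eq (hr : 3 ≤ r) (hs : 3 ≤ s) (hℓ : 1 ≤ ℓ) (hr_odd : Odd r) (hs_odd : Odd s) :
    (Φ.shifted t).det
      = ((kerZ r s ℓ t - alpha hr Φ * beta hs Φ * kerW r s ℓ t : ℝ) : ℂ)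
        + ((-(alpha hr Φ * kerX r s ℓ t + beta hs Φ * kerY r s ℓ t) : ℝ) : ℂ) * Complex.I := by
  obtain rfl | ⟨n, rfl⟩ : ℓ = 1 ∨ ∃ n, ℓ = n + 2 := by
    rcases eq_or_ne ℓ 1 with h | h
    · exact Or.inl h
    · exact Or.inr ⟨ℓ - 2, by omega⟩
  · rw [det_shifted_of_bridge t hr hs hr_odd hs_odd Φ, fval_ofReal, fval_ofReal]
    simp only [cycleDet, kerZ, kerW, kerX, kerY, polyR, polyS, polyM, polyT, if_true]
    rw [f_eq_fAux (j := ((1 : ℕ) : ℤ) - 1) 1 (by simp),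
      f_eq_fAux (j := ((1 : ℕ) : ℤ) - 2) 0 (by simp), f_eq_fAux (j := (r : ℤ) - 1) r (by ring),
      f_eq_fAux (j := (s : ℤ) - 1) s (by ring)]
    simp only [fAux, eval_add, eval_mul, eval_X, eval_one, eval_zero]
    push_cast
    linear_combination (4 * (alpha hr Φ : ℂ) * beta hs Φ * t ^ (r + s)) * Complex.I_sq
  · rw [det_shifted_of_path t hr hs hr_odd hs_odd Φ _ rfl]
    simp only [fval_ofReal]
    simp only [cycleDet, kerZ, kerW, kerX, kerY, polyR, polyS, polyM, polyT,
      if_neg (show n + 2 ≠ 1 by omega)]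
    rw [f_eq_fAux (j := ((n + 2 : ℕ) : ℤ) - 1) (n + 2) (by push_cast; ring),
      f_eq_fAux (j := ((n + 2 : ℕ) : ℤ) - 2) (n + 1) (by push_cast; ring),
      f_eq_fAux (j := ((n + 2 : ℕ) : ℤ) - 3) n (by push_cast; ring),
      f_eq_fAux (j := (r : ℤ) - 1) r (by ring), f_eq_fAux (j := (s : ℤ) - 1) s (by ring)]
    simp only [eval_add, eval_mul, eval_pow, eval_X]
    push_cast
    linear_combination (4 * (alpha hr Φ : ℂ) * beta hs Φ * t ^ (r + s)
      * (((fAux (n + 2)).eval (t ^ 2) : ℝ) : ℂ)) * Complex.I_sq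

theorem kernelK_eq_normSq (hr : 3 ≤ r) (hs : 3 ≤ s) (hℓ : 1 ≤ ℓ) (hr_odd : Odd r)
    (hs_odd : Odd s) :
    kernelK r s ℓ (alpha hr Φ) (beta hs Φ) t = Complex.normSq (Φ.shifted t).det := by
  rw [det_shifted_eq Φ t hr hs hℓ hr_odd hs_odd, Complex.normSq_add_mul_I, kernelK]
  ring

end Dumbbell
end GainDumbbell

theorem mainTheorem4 (r s ℓ : ℕ) (hr : 3 ≤ r) (hs : 3 ≤ s) (hℓ : 1 ≤ ℓ)
    (hr_odd : Odd r) (hs_odd : Odd s) :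
    (∀ Φ : GainDumbbell.UnitGain (GainDumbbell.dumbbell r s ℓ),
      (∀ t : ℝ, 0 < t →
        0 < GainDumbbell.kernelK r s ℓ (GainDumbbell.alpha hr Φ) (GainDumbbell.beta hs Φ) t) ∧
      MeasureTheory.IntegrableOn
        (fun t : ℝ => 1 / t ^ 2 * Real.log
          (GainDumbbell.kernelK r s ℓ (GainDumbbell.alpha hr Φ) (GainDumbbell.beta hs Φ) t))
        (Set.Ioi 0) ∧
      Φ.energy = 1 / Real.pi * ∫ t in Set.Ioi (0 : ℝ), 1 / t ^ 2 * Real.log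
        (GainDumbbell.kernelK r s ℓ (GainDumbbell.alpha hr Φ) (GainDumbbell.beta hs Φ) t)) ∧
    (GainDumbbell.polyR s ℓ * GainDumbbell.polyS r ℓ
        - GainDumbbell.polyM r s ℓ * GainDumbbell.polyT ℓ
      = (-1) ^ ℓ * Polynomial.X ^ ℓ * GainDumbbell.f (r - 1) * GainDumbbell.f (s - 1)) ∧
    (∀ t : ℝ, 0 < t →
      Real.sign (GainDumbbell.kerX r s ℓ t * GainDumbbell.kerY r s ℓ t
        - GainDumbbell.kerZ r s ℓ t * GainDumbbell.kerW r s ℓ t) = (-1) ^ ℓ) := by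
  refine ⟨fun Φ => ?_, GainDumbbell.polyR_mul_polyS_sub r s ℓ hℓ, fun t ht =>
    GainDumbbell.sign_kernel r s ℓ (by omega) (by omega) hℓ ht⟩
  exact Φ.energy_eq_integral _ fun t _ =>
    GainDumbbell.kernelK_eq_normSq Φ t hr hs hℓ hr_odd hs_odd
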